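/- **Setting.** Let $\mathcal K_d$ be the set of $d\times d$ correlation matrices (symmetric positive definite with unit diagonal); the copula parameter $\varrho$ (the off-diagonal entries) is identified with its matrix $\mathbf R\in\mathcal K_d$. Let $\Phi$ be the standard normal cdf, $\varphi_d(\cdot;\mathbf R)$ and $\Phi_d(\cdot;\mathbf R)$ the density and cdf of $N_d(0,\mathbf R)$, and let $$C(u;\mathbf R)=\Phi_d(\Phi^{-1}(u_1),\dots,\Phi^{-1}(u_d);\mathbf R),\qquad c(u;\mathbf R)=\frac{\varphi_d(\Phi^{-1}(u_1),\dots,\Phi^{-1}(u_d);\mathbf R)}{\varphi_d(\Phi^{-1}(u_1),\dots,\Phi^{-1}(u_d);\mathbf I_d)}$$ be the Gaussian copula and its density. For $i=1,\dots,d$ let $\psi_i(\cdot;\theta_i)$, $\theta_i\in\Theta_i$, be a parametric family of continuous probability densities on $(0,\infty)$ with cdfs $\Psi_i(\cdot;\theta_i)$. For $p\in(0,1]^d$ let $F_i(x;p_i)=(1-p_i)\mathbb 1_{\{x\ge 0\}}+p_i\Psi_i(x;\theta_i)\mathbb 1_{\{x>0\}}$. A sample of the Gaussian-copula Comb-Bernoulli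 model consists of $N$ independent random vectors in $\mathbb R^d$ with marginal cdfs $F_i(\cdot;p_i)$ and joint cdf $C(F_1(x_1;p_1),\dots,F_d(x_d;p_d);\mathbf R)$. With $\mathcal S(x)=\{i:x_i>0\}$, the log-likelihood of a sample $\mathcal X=(x^{(t)})_{t\le N}$ and its limiting form are $$\mathcal L_p(\Theta,\mathbf R\mid\mathcal X)=\sum_{x\in\mathcal X}\Big\{\ln\Big[\tfrac{\partial^{|\mathcal S(x)|}C(u;\mathbf R)}{\prod_{i\in\mathcal S(x)}\partial u_i}\Big]_{u_i=F_i(x_i;p_i)}+\sum_{i\in\mathcal S(x)}\ln\big(p_i\psi_i(x_i;\theta_i)\big)\Big\},$$ $$\mathcal L(\Theta,\mathbf R\mid\mathcal X)=\sum_{x\in\mathcal X}\Big\{\ln c\big(\Psi_1(x_1;\theta_1),\dots,\Psi_d(x_d;\theta_d);\mathbf R\big)+\sum_{i\in\mathcal S(x)}\ln\psi_i(x_i;\theta_i)\Big\},$$ where $\ln 0=-\infty$. For each $i$, the marginal MLE $(\widehat p_i,\widehat\theta_i)$ is a function of the $i$-th components of the sample that maximizes, over $(0,1]\times\Theta_i$,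 the marginal likelihood $\prod_{t:\,x^{(t)}_i>0}p_i\psi_i(x_i^{(t)};\theta_i)\prod_{t:\,x_i^{(t)}=0}(1-p_i)$. **Assumptions.** Let $d,N\in\mathbb N$, and fix true parameters $\theta^0_i\in\Theta_i$ and $\mathbf R^0\in\mathcal K_d$. On one probability space, for each $p\in(0,1]^d$, let $\mathcal X_p$ be a sample of length $N$ of the model with parameters $p,\theta^0,\mathbf R^0$; write $\mathcal X=\mathcal X_{\mathbf 1}$ for the full sample ($p=\mathbf 1=(1,\dots,1)$). Assume that almost surely the marginal MLEs exist on $\mathcal X$, and that almost surely the fitted normal score vectors $\big(\Phi^{-1}(\Psi_i(x_i^{(t)};\widehat\theta_i))\big)_{i\le d}$, $t=1,\dots,N$, of $\mathcal X$ span $\mathbb R^d$. For random functions $L_p$ ($p\in(0,1]^d$) and $L$ on $\mathcal K_d$, say that *the maximizers of $L_p$ converge to those of $L$* if, as $p\to\mathbf 1$ within $(0,1]^d$: $L$ has a maximizer over $\mathcal K_d$; $L_p$ has a maximizer over $\mathcal K_d$ for all $p$ close enough to $\mathbf 1$; every open set containing all maximizers of $L$ contains all maximizers of $L_p$ for $p$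 close enough to $\mathbf 1$; and, if $L$ has exactly one maximizer $\widehat\varrho$, then $\widehat\varrho_p\to\widehat\varrho$ for every choice of maximizers $\widehat\varrho_p$ of $L_p$. **Theorem.** 1. *(Sample and first-stage estimates held fixed.)* Let $\widehat\Theta=\widehat\Theta(\mathcal X)$. Almost surely, the maximizers of $\mathcal L_p(\widehat\Theta,\cdot\mid\mathcal X)$ converge to those of $\mathcal L(\widehat\Theta,\cdot\mid\mathcal X)$. 2. *(Sample varying with $p$.)* Suppose moreover that almost surely, as $p\to\mathbf 1$ within $(0,1]^d$: the marginal MLEs $\widehat p,\widehat\Theta$ exist on $\mathcal X_p$ for $p$ close to $\mathbf 1$; $\mathcal X_p\to\mathcal X$; and the fitted severity cdfs converge, i.e. $\Psi_i(x;\widehat\theta_i(\mathcal X_p))\to\Psi_i(x;\widehat\theta_i(\mathcal X))$ for all $i$ and $x>0$. Then almost surely the maximizers of the IFM objective $\mathcal L_{\widehat p(\mathcal X_p)}(\widehat\Theta(\mathcal X_p),\cdot\mid\mathcal X_p)$, and also those of $\mathcal L_{p}(\widehat\Theta(\mathcal X_p),\cdot\mid\mathcal X_p)$, converge to those of $\mathcal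 L(\widehat\Theta(\mathcal X),\cdot\mid\mathcal X)$. In particular, whenever $\widehat\varrho:=\operatorname{argmax}_{\varrho\in\mathcal K_d}\mathcal L(\widehat\Theta,\varrho\mid\mathcal X)$ is uniquely defined, the IFM estimator $\widehat\varrho_p$ converges almost surely to $\widehat\varrho$ as $p\to\mathbf 1$. -/

import Mathlib

open MeasureTheory ProbabilityTheory Filter Topology Set

namespace CombBernoulli

noncomputable section

/-! ### The Gaussian copula -/

/-- `𝒦_d`: (nondegenerate) correlation matrices, i.e. positive definite symmetric matrices with
unit diagonal. The copula parameter, the vector of off-diagonal entries, is identified with it. -/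
def corrMatrices (d : ℕ) : Set (Matrix (Fin d) (Fin d) ℝ) :=
  {R | R.PosDef ∧ ∀ i, R i i = 1}

/-- The standard normal distribution function `Φ`. -/
def stdNormalCdf (x : ℝ) : ℝ := cdf (gaussianReal 0 1) x

/-- `Φ⁻¹`, with values in the extended reals: `Φ⁻¹(0) = -∞` and `Φ⁻¹(1) = +∞`. -/
def probit (u : ℝ) : EReal := sInf ((fun x : ℝ => (x : EReal)) '' {x : ℝ | u ≤ stdNormalCdf x})

/-- `φ_d(z; R)`: the density of the centered Gaussian distribution with covariance matrix `R`. -/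
def gaussianDensity {d : ℕ} (R : Matrix (Fin d) (Fin d) ℝ) (z : Fin d → ℝ) : ℝ :=
  (Real.sqrt ((2 * Real.pi) ^ d * R.det))⁻¹ * Real.exp (-(z ⬝ᵥ (R⁻¹.mulVec z)) / 2)

/-- `Φ_d(z; R)`: the distribution function of the centered Gaussian distribution with covariance
matrix `R`; the arguments may be infinite. -/
def gaussianCdf {d : ℕ} (R : Matrix (Fin d) (Fin d) ℝ) (z : Fin d → EReal) : ℝ :=
  ∫ y in {y : Fin d → ℝ | ∀ i, (y i : EReal) ≤ z i}, gaussianDensity R y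

/-- The Gaussian copula `C(u; R) = Φ_d(Φ⁻¹(u₁), …, Φ⁻¹(u_d); R)`. -/
def gaussianCopula {d : ℕ} (R : Matrix (Fin d) (Fin d) ℝ) (u : Fin d → ℝ) : ℝ :=
  gaussianCdf R (fun i => probit (u i))

/-- The Gaussian copula density
`c(u; R) = φ_d(Φ⁻¹(u₁), …, Φ⁻¹(u_d); R) / φ_d(Φ⁻¹(u₁), …, Φ⁻¹(u_d); I)`. -/
def gaussianCopulaDensity {d : ℕ} (R : Matrix (Fin d) (Fin d) ℝ) (u : Fin d → ℝ) : ℝ :=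
  gaussianDensity R (fun i => (probit (u i)).toReal) /
    gaussianDensity 1 (fun i => (probit (u i)).toReal)

/-! ### Mixed partial derivatives -/

/-- The partial derivative of `f` in the `i`-th coordinate. -/
def partialDeriv {d : ℕ} (i : Fin d) (f : (Fin d → ℝ) → ℝ) (u : Fin d → ℝ) : ℝ :=
  deriv (fun s => f (Function.update u i s)) (u i)

/-- `∂^{|S|} f / ∏_{i ∈ S} ∂u_i`. -/
def mixedPartial {d : ℕ} (S : Finset (Fin d)) (f : (Fin d → ℝ) → ℝ) : (Fin d → ℝ) → ℝ :=
  S.sort.foldr partialDeriv f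

/-! ### Severities and marginals -/

/-- A parametric family of claim severities: continuous probability densities on `(0, ∞)`. -/
structure SeverityFamily (Θ : Type*) where
  pdf : Θ → ℝ → ℝ
  continuousOn_pdf : ∀ θ, ContinuousOn (pdf θ) (Ioi 0)
  pdf_nonneg : ∀ θ x, 0 < x → 0 ≤ pdf θ x
  integrableOn_pdf : ∀ θ, IntegrableOn (pdf θ) (Ioi 0)
  integral_pdf : ∀ θ, ∫ x in Ioi (0 : ℝ), pdf θ x = 1

/-- The severity distribution function `Ψ(x; θ)`. -/
def SeverityFamily.cdf {Θ : Type*} (F : SeverityFamily Θ) (θ : Θ) (x : ℝ) : ℝ :=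
  ∫ y in Ioc 0 x, F.pdf θ y

/-- The marginal distribution function
`F(x; p) = (1 - p) 1_{x ≥ 0} + p Ψ(x; θ) 1_{x > 0}`. -/
def marginalCdf {Θ : Type*} (F : SeverityFamily Θ) (p : ℝ) (θ : Θ) (x : ℝ) : ℝ :=
  (1 - p) * (if 0 ≤ x then 1 else 0) + p * F.cdf θ x * (if 0 < x then 1 else 0)

/-- The likelihood of a univariate sample of non-negative claims: each zero contributes the atom
`1 - p`, each positive claim `x` contributes the density `p ψ(x; θ)`. -/
def marginalLikelihood {Θ : Type*} {N : ℕ} (F : SeverityFamily Θ) (x : Fin N → ℝ)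
    (p : ℝ) (θ : Θ) : ℝ :=
  ∏ t, if 0 < x t then p * F.pdf θ (x t) else 1 - p

/-- `(p, θ)` is a maximum likelihood estimate of one marginal, over `p ∈ (0, 1]` and all `θ`. -/
def IsMarginalMLE {Θ : Type*} {N : ℕ} (F : SeverityFamily Θ) (x : Fin N → ℝ)
    (p : ℝ) (θ : Θ) : Prop :=
  p ∈ Ioc (0 : ℝ) 1 ∧
    ∀ q ∈ Ioc (0 : ℝ) 1, ∀ η : Θ, marginalLikelihood F x q η ≤ marginalLikelihood F x p θ

/-! ### The multivariate model and its likelihood -/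

/-- The admissible occurrence probabilities, `(0, 1]^d`. -/
def occurrenceBox (d : ℕ) : Set (Fin d → ℝ) := {p | ∀ i, p i ∈ Ioc (0 : ℝ) 1}

/-- The limit `p → 1` within `(0, 1]^d`. -/
def toOne (d : ℕ) : Filter (Fin d → ℝ) := 𝓝[occurrenceBox d] 1

/-- `X` is a sample of length `N` from the `d`-dimensional Gaussian-copula Comb-Bernoulli model with
occurrence probabilities `p`, severity parameters `θ` and copula correlation matrix `R`. -/
structure IsSample {Ω : Type*} [MeasurableSpace Ω] (μ : Measure Ω) {d N : ℕ} {Θ : Fin d → Type*}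
    (F : ∀ i, SeverityFamily (Θ i)) (p : Fin d → ℝ) (θ : ∀ i, Θ i)
    (R : Matrix (Fin d) (Fin d) ℝ) (X : Fin N → Ω → Fin d → ℝ) : Prop where
  measurable : ∀ t, Measurable (X t)
  indep : iIndepFun X μ
  marginal : ∀ t i x, μ.real {ω | X t ω i ≤ x} = marginalCdf (F i) (p i) (θ i) x
  joint : ∀ t (x : Fin d → ℝ), μ.real {ω | ∀ i, X t ω i ≤ x i} =
    gaussianCopula R (fun i => marginalCdf (F i) (p i) (θ i) (x i))

/-- The active set of an observation. -/
def activeSet {d : ℕ} (x : Fin d → ℝ) : Finset (Fin d) := Finset.univ.filter fun i => 0 < x i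

/-- The logarithm of a likelihood, with `log 0 = -∞`. -/
def elog (y : ℝ) : EReal := ENNReal.log (ENNReal.ofReal y)

/-- The log-likelihood `𝓛_p(Θ, R | 𝒳)` of the model. -/
def logLik {d N : ℕ} {Θ : Fin d → Type*} (F : ∀ i, SeverityFamily (Θ i)) (p : Fin d → ℝ)
    (θ : ∀ i, Θ i) (x : Fin N → Fin d → ℝ) (R : Matrix (Fin d) (Fin d) ℝ) : EReal :=
  ∑ t, (elog (mixedPartial (activeSet (x t)) (gaussianCopula R)
          (fun i => marginalCdf (F i) (p i) (θ i) (x t i)))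
        + ∑ i ∈ activeSet (x t), elog (p i * (F i).pdf (θ i) (x t i)))

/-- The limiting log-likelihood `𝓛(Θ, R | 𝒳)`, i.e. that of the Gaussian copula with continuous
marginals. -/
def limitLogLik {d N : ℕ} {Θ : Fin d → Type*} (F : ∀ i, SeverityFamily (Θ i))
    (θ : ∀ i, Θ i) (x : Fin N → Fin d → ℝ) (R : Matrix (Fin d) (Fin d) ℝ) : EReal :=
  ∑ t, (elog (gaussianCopulaDensity R (fun i => (F i).cdf (θ i) (x t i)))
        + ∑ i ∈ activeSet (x t), elog ((F i).pdf (θ i) (x t i)))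

/-- The normal scores `Φ⁻¹(Ψ_i(x_i; θ_i))`, `i = 1, …, d`, of an observation. -/
def normalScores {d : ℕ} {Θ : Fin d → Type*} (F : ∀ i, SeverityFamily (Θ i))
    (θ : ∀ i, Θ i) (x : Fin d → ℝ) : Fin d → ℝ :=
  fun i => (probit ((F i).cdf (θ i) (x i))).toReal

/-! ### Maximizers -/

/-- The set of maximizers over `𝒦_d` of a function of the correlation matrix. -/
def argmaxCorr {d : ℕ} (L : Matrix (Fin d) (Fin d) ℝ → EReal) : Set (Matrix (Fin d) (Fin d) ℝ) :=
  {R | R ∈ corrMatrices d ∧ ∀ R' ∈ corrMatrices d, L R' ≤ L R}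

/-- Convergence of the maximizers of `Lp p` to those of `L` as `p → 1`: maximizers of `L` exist,
maximizers of `Lp p` exist for `p` close to `1`, every neighbourhood of the maximizers of `L`
contains the maximizers of `Lp p` for `p` close to `1`, and if `L` has exactly one maximizer `ρ`
then every choice of maximizers `r p` of `Lp p` converges to `ρ`. -/
def MaximizersConverge {d : ℕ} (Lp : (Fin d → ℝ) → Matrix (Fin d) (Fin d) ℝ → EReal)
    (L : Matrix (Fin d) (Fin d) ℝ → EReal) : Prop :=
  (argmaxCorr L).Nonempty ∧
  (∀ᶠ p in toOne d, (argmaxCorr (Lp p)).Nonempty) ∧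
  (∀ V : Set (Matrix (Fin d) (Fin d) ℝ), IsOpen V → argmaxCorr L ⊆ V →
    ∀ᶠ p in toOne d, argmaxCorr (Lp p) ⊆ V) ∧
  (∀ (ρ : Matrix (Fin d) (Fin d) ℝ) (r : (Fin d → ℝ) → Matrix (Fin d) (Fin d) ℝ),
    argmaxCorr L = {ρ} → (∀ᶠ p in toOne d, r p ∈ argmaxCorr (Lp p)) →
      Tendsto r (toOne d) (𝓝 ρ))

end

end CombBernoulli

namespace CombBernoulli

/-! ### The standard normal distribution function and its inverse -/

/-! Almost surely every claim of the full sample is positive and has positive true density. A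
marginal MLE must do at least as well as the true parameter, so the fitted densities are positive at
the data too, and by continuity of the densities the fitted cdf values lie strictly between 0 and 1.
All of this survives for `p` near 1. The active sets are then full, and the mixed partial over all
coordinates is the copula density (`mixedPartial_gaussianCopula`). Up to a constant free of `R`,
both log-likelihoods are therefore half of one function, `profile Z R = -N log det R - ∑ zₜᵀ R⁻¹
zₜ`, evaluated at scores `Z_p` that tend to `Z`. The theorem becomes a statement about the argmax of
`profile` as `Z` varies.

Since `𝒦_d` is not compact, coercivity is needed. Spanning scores give `∑ yₜᵀ A yₜ ≥ ε tr A` for all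
positive semidefinite `A`, uniformly for `Y` near `Z`. With `τ = tr R⁻¹` and `det R⁻¹ ≤ τ^d`, the
profile is at most `N d log τ - ε τ`, and `τ` is large when `det R` is small. Such `R` lose to the
identity (`exists_eventually_profile_lt`), so maximizers stay in a compact set `det R ≥ δ`, where
joint continuity yields existence and upper semicontinuity.

When the sample also varies, its claims are all positive for `p` near 1, so the estimated occurrence
probabilities equal 1 exactly. The two objectives of the second part are then instances of the same
lemma, `maximizersConverge_logLik`. -/

lemma hasDerivAt_setIntegral_Iic {f : ℝ → ℝ} (hf : Integrable f) (hc : Continuous f) (x : ℝ) :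
    HasDerivAt (fun s => ∫ y in Iic s, f y) (f x) x := by
  have h1 : (fun s => ∫ y in Iic s, f y) =
      fun s => (∫ y in Iic (0 : ℝ), f y) + ∫ y in 0..s, f y := by
    funext s
    rw [← intervalIntegral.integral_Iic_sub_Iic hf.integrableOn hf.integrableOn]
    ring
  rw [h1]
  exact (intervalIntegral.integral_hasDerivAt_right (hc.intervalIntegrable _ _)
    (hc.stronglyMeasurableAtFilter _ _) hc.continuousAt).const_add _

lemma continuous_gaussianPDFReal : Continuous (gaussianPDFReal 0 1) := by
  unfold gaussianPDFReal
  fun_prop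

lemma hasDerivAt_stdNormalCdf (x : ℝ) :
    HasDerivAt stdNormalCdf (gaussianPDFReal 0 1 x) x := by
  have h : stdNormalCdf = fun s => ∫ y in Iic s, gaussianPDFReal 0 1 y := by
    funext s
    rw [stdNormalCdf, cdf_eq_real, measureReal_def,
      gaussianReal_apply_eq_integral 0 one_ne_zero, ENNReal.toReal_ofReal]
    exact integral_nonneg fun y => gaussianPDFReal_nonneg _ _ _
  rw [h]
  exact hasDerivAt_setIntegral_Iic (integrable_gaussianPDFReal 0 1) continuous_gaussianPDFReal x

lemma strictMono_stdNormalCdf : StrictMono stdNormalCdf :=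
  strictMono_of_deriv_pos fun x => by
    rw [(hasDerivAt_stdNormalCdf x).deriv]
    exact gaussianPDFReal_pos _ _ _ one_ne_zero

lemma continuous_stdNormalCdf : Continuous stdNormalCdf :=
  continuous_iff_continuousAt.2 fun x => (hasDerivAt_stdNormalCdf x).continuousAt

lemma stdNormalCdf_mem_Ioo (x : ℝ) : stdNormalCdf x ∈ Ioo (0 : ℝ) 1 := by
  constructor
  · exact (cdf_nonneg _ (x - 1)).trans_lt (strictMono_stdNormalCdf (sub_one_lt x))
  · exact (strictMono_stdNormalCdf (lt_add_one x)).trans_le (cdf_le_one _ (x + 1))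

lemma exists_stdNormalCdf_eq {u : ℝ} (hu : u ∈ Ioo (0 : ℝ) 1) : ∃ x, stdNormalCdf x = u := by
  obtain ⟨a, ha⟩ := ((tendsto_cdf_atBot (gaussianReal 0 1)).eventually (gt_mem_nhds hu.1)).exists
  obtain ⟨b, hb⟩ := ((tendsto_cdf_atTop (gaussianReal 0 1)).eventually (lt_mem_nhds hu.2)).exists
  exact mem_range_of_exists_le_of_exists_ge continuous_stdNormalCdf ⟨a, ha.le⟩ ⟨b, hb.le⟩

lemma probit_stdNormalCdf (x : ℝ) : probit (stdNormalCdf x) = x := by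
  have h : {y : ℝ | stdNormalCdf x ≤ stdNormalCdf y} = Ici x := by
    ext y
    exact strictMono_stdNormalCdf.le_iff_le
  rw [probit, h]
  refine IsLeast.csInf_eq ⟨⟨x, self_mem_Ici, rfl⟩, ?_⟩
  rintro _ ⟨y, hy, rfl⟩
  exact EReal.coe_le_coe_iff.2 hy

/-- The normal score `Φ⁻¹(u)` as a real number. -/
noncomputable def score (u : ℝ) : ℝ := (probit u).toReal

lemma score_stdNormalCdf (x : ℝ) : score (stdNormalCdf x) = x := by
  rw [score, probit_stdNormalCdf, EReal.toReal_coe]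

lemma stdNormalCdf_score {u : ℝ} (hu : u ∈ Ioo (0 : ℝ) 1) : stdNormalCdf (score u) = u := by
  obtain ⟨x, rfl⟩ := exists_stdNormalCdf_eq hu
  rw [score_stdNormalCdf]

lemma probit_eq_score {u : ℝ} (hu : u ∈ Ioo (0 : ℝ) 1) : probit u = score u := by
  obtain ⟨x, rfl⟩ := exists_stdNormalCdf_eq hu
  rw [score_stdNormalCdf, probit_stdNormalCdf]

/-- A strictly monotone function on an interval whose image is a neighbourhood of its value cannot
jump; here the image is all of `ℝ`. -/
lemma continuousAt_score {u : ℝ} (hu : u ∈ Ioo (0 : ℝ) 1) : ContinuousAt score u := by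
  have hmono : StrictMonoOn score (Ioo 0 1) := fun a ha b hb hab => by
    rw [← strictMono_stdNormalCdf.lt_iff_lt, stdNormalCdf_score ha, stdNormalCdf_score hb]
    exact hab
  refine hmono.continuousAt_of_image_mem_nhds (Ioo_mem_nhds hu.1 hu.2) ?_
  have : score '' Ioo 0 1 = univ :=
    eq_univ_of_forall fun x => ⟨stdNormalCdf x, stdNormalCdf_mem_Ioo x, score_stdNormalCdf x⟩
  rw [this]
  exact univ_mem

lemma hasDerivAt_score {u : ℝ} (hu : u ∈ Ioo (0 : ℝ) 1) :
    HasDerivAt score (gaussianPDFReal 0 1 (score u))⁻¹ u := by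
  refine (hasDerivAt_stdNormalCdf (score u)).of_local_left_inverse (continuousAt_score hu)
    (gaussianPDFReal_pos _ _ _ one_ne_zero).ne' ?_
  filter_upwards [Ioo_mem_nhds hu.1 hu.2] with v hv using stdNormalCdf_score hv

/-! ### Iterated integrals over lower orthants -/

/-- A continuous nonnegative function that is dominated by a product of a fixed weight over the
coordinates outside of `T`. -/
structure IsDominated {d : ℕ} (w : ℝ → ℝ) (T : Finset (Fin d)) (g : (Fin d → ℝ) → ℝ) : Prop where
  continuous : Continuous g
  nonneg : ∀ z, 0 ≤ g z
  bound : ∃ C, 0 ≤ C ∧ ∀ z, g z ≤ C * ∏ j ∈ Tᶜ, w (z j)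

lemma prod_compl_update {d : ℕ} (w : ℝ → ℝ) {T : Finset (Fin d)} {i : Fin d} (hi : i ∉ T)
    (z : Fin d → ℝ) (r : ℝ) :
    ∏ j ∈ Tᶜ, w (Function.update z i r j) = w r * ∏ j ∈ (insert i T)ᶜ, w (z j) := by
  have h : Tᶜ = insert i (insert i T)ᶜ := by
    ext j
    by_cases hj : j = i <;> simp [hj, hi]
  rw [h, Finset.prod_insert (by simp), Function.update_self]
  congr 1
  refine Finset.prod_congr rfl fun j hj => ?_
  have : j ≠ i := by rintro rfl; simp at hj
  rw [Function.update_of_ne this]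

lemma IsDominated.exists_bound_update {d : ℕ} {w : ℝ → ℝ} {T : Finset (Fin d)}
    {g : (Fin d → ℝ) → ℝ} (hg : IsDominated w T g) {i : Fin d} (hi : i ∉ T) :
    ∃ C, 0 ≤ C ∧ ∀ z r, g (Function.update z i r) ≤ C * w r * ∏ j ∈ (insert i T)ᶜ, w (z j) := by
  obtain ⟨C, hC, hb⟩ := hg.bound
  refine ⟨C, hC, fun z r => (hb _).trans_eq ?_⟩
  rw [prod_compl_update w hi, mul_assoc]

lemma IsDominated.continuous_update {d : ℕ} {w : ℝ → ℝ} {T : Finset (Fin d)}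
    {g : (Fin d → ℝ) → ℝ} (hg : IsDominated w T g) (z : Fin d → ℝ) (i : Fin d) :
    Continuous fun r => g (Function.update z i r) :=
  hg.continuous.comp (continuous_const.update i continuous_id)

lemma IsDominated.integrable_update {d : ℕ} {w : ℝ → ℝ} (hw : Integrable w)
    {T : Finset (Fin d)} {g : (Fin d → ℝ) → ℝ} (hg : IsDominated w T g) {i : Fin d} (hi : i ∉ T)
    (z : Fin d → ℝ) : Integrable fun r => g (Function.update z i r) := by
  obtain ⟨C, hC, hb⟩ := hg.exists_bound_update hi
  refine ((hw.const_mul C).mul_const (∏ j ∈ (insert i T)ᶜ, w (z j))).mono'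
    (hg.continuous_update z i).aestronglyMeasurable
    (ae_of_all _ fun r => ?_)
  rw [Real.norm_of_nonneg (hg.nonneg _)]
  exact hb z r

/-- This is what allows coordinates to be integrated out one at a time: the bound loses the factor
of coordinate `i` and gains `∫ w`. Continuity is dominated convergence; `w ≤ 1` makes the dominating
function independent of the base point. -/
lemma IsDominated.setIntegral_Iic {d : ℕ} {w : ℝ → ℝ} (hw : Integrable w)
    (hw0 : ∀ r, 0 ≤ w r) (hw1 : ∀ r, w r ≤ 1) {T : Finset (Fin d)} {g : (Fin d → ℝ) → ℝ}
    (hg : IsDominated w T g) {i : Fin d} (hi : i ∉ T) :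
    IsDominated w (insert i T) fun z => ∫ r in Iic (z i), g (Function.update z i r) := by
  obtain ⟨C, hC, hb⟩ := hg.exists_bound_update hi
  have hprod : ∀ z : Fin d → ℝ, ∏ j ∈ (insert i T)ᶜ, w (z j) ≤ 1 := fun z =>
    Finset.prod_le_one (fun _ _ => hw0 _) fun _ _ => hw1 _
  have hprod0 : ∀ z : Fin d → ℝ, 0 ≤ ∏ j ∈ (insert i T)ᶜ, w (z j) := fun z =>
    Finset.prod_nonneg fun _ _ => hw0 _
  refine ⟨?_, fun z => integral_nonneg fun r => hg.nonneg _, C * ∫ r, w r,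
    mul_nonneg hC (integral_nonneg hw0), fun z => ?_⟩
  · simp_rw [← integral_indicator measurableSet_Iic]
    refine continuous_iff_continuousAt.2 fun z => ?_
    refine continuousAt_of_dominated (bound := fun r => C * w r)
      (Eventually.of_forall fun y => ?_) (Eventually.of_forall fun y => ae_of_all _ fun r => ?_)
      (hw.const_mul C) ?_
    · exact (hg.continuous_update y i).aestronglyMeasurable.indicator measurableSet_Iic
    · refine (norm_indicator_le_norm_self _ _).trans ?_
      rw [Real.norm_of_nonneg (hg.nonneg _)]
      exact (hb y r).trans (mul_le_of_le_one_right (mul_nonneg hC (hw0 r)) (hprod y))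
    -- The moving endpoint matters only at `r = z i`, a null set; for any other `r` the indicator is
    -- locally constant in the base point.
    · have hne : ∀ᵐ r : ℝ, r ≠ z i := by simp [ae_iff]
      filter_upwards [hne] with r hr
      have hcont : ContinuousAt (fun y : Fin d → ℝ => g (Function.update y i r)) z :=
        (hg.continuous.comp (continuous_id.update i continuous_const)).continuousAt
      rcases lt_or_gt_of_ne hr with h | h
      · refine hcont.congr ?_
        filter_upwards [(continuousAt_apply i z).eventually (lt_mem_nhds h)] with y hy
        exact (indicator_of_mem (mem_Iic.2 (le_of_lt hy)) (fun r => g (Function.update y i r))).symm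
      · refine (continuousAt_const (y := (0 : ℝ))).congr ?_
        filter_upwards [(continuousAt_apply i z).eventually (gt_mem_nhds h)] with y hy
        exact (indicator_of_notMem (notMem_Iic.2 hy) (fun r => g (Function.update y i r))).symm
  · calc ∫ r in Iic (z i), g (Function.update z i r)
        ≤ ∫ r, g (Function.update z i r) :=
          setIntegral_le_integral (hg.integrable_update hw hi z) (ae_of_all _ fun r => hg.nonneg _)
      _ ≤ ∫ r, C * w r * ∏ j ∈ (insert i T)ᶜ, w (z j) :=
          integral_mono (hg.integrable_update hw hi z) ((hw.const_mul C).mul_const _) (hb z)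
      _ = _ := by rw [integral_mul_const, integral_const_mul]

/-- The integral of `f` over the coordinates in `T`, each from `-∞` to the corresponding coordinate
of the argument. -/
noncomputable def orthantIntegral {d : ℕ} (f : (Fin d → ℝ) → ℝ) (T : Finset (Fin d))
    (z : Fin d → ℝ) : ℝ :=
  (lmarginal (fun i => volume.restrict (Iic (z i))) T (fun y => ENNReal.ofReal (f y)) z).toReal

lemma orthantIntegral_empty {d : ℕ} {f : (Fin d → ℝ) → ℝ} (hf : ∀ z, 0 ≤ f z) :
    orthantIntegral f ∅ = f := by
  funext z
  rw [orthantIntegral, lmarginal_empty, ENNReal.toReal_ofReal (hf z)]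

lemma lmarginal_congr_measure {d : ℕ} {μ ν : Fin d → Measure ℝ} {T : Finset (Fin d)}
    (h : ∀ i ∈ T, μ i = ν i) (f : (Fin d → ℝ) → ENNReal) : lmarginal μ T f = lmarginal ν T f := by
  funext z
  have : (fun i : T => μ i) = fun i : T => ν i := funext fun i => h i i.2
  rw [lmarginal, lmarginal, this]

/-- Domination keeps the `ENNReal` integral finite, so `toReal` loses nothing. The last clause
drives the induction on `T` and is also the form in which a coordinate can be differentiated. -/
lemma orthantIntegral_spec {d : ℕ} {w : ℝ → ℝ} (hw : Integrable w) (hw0 : ∀ r, 0 ≤ w r)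
    (hw1 : ∀ r, w r ≤ 1) {f : (Fin d → ℝ) → ℝ} (hf : IsDominated w ∅ f) (T : Finset (Fin d)) :
    (IsDominated w T (orthantIntegral f T) ∧
      ∀ z, lmarginal (fun i => volume.restrict (Iic (z i))) T (fun y => ENNReal.ofReal (f y)) z =
        ENNReal.ofReal (orthantIntegral f T z)) ∧
    ∀ i ∉ T, ∀ z, lmarginal (fun i => volume.restrict (Iic (z i))) (insert i T)
      (fun y => ENNReal.ofReal (f y)) z =
        ENNReal.ofReal (∫ r in Iic (z i), orthantIntegral f T (Function.update z i r)) := by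
  have key : ∀ T : Finset (Fin d), IsDominated w T (orthantIntegral f T) →
      (∀ z, lmarginal (fun i => volume.restrict (Iic (z i))) T (fun y => ENNReal.ofReal (f y)) z =
        ENNReal.ofReal (orthantIntegral f T z)) →
      ∀ i ∉ T, ∀ z, lmarginal (fun i => volume.restrict (Iic (z i))) (insert i T)
        (fun y => ENNReal.ofReal (f y)) z =
          ENNReal.ofReal (∫ r in Iic (z i), orthantIntegral f T (Function.update z i r)) := by
    intro T hdom heq i hi z
    rw [lmarginal_insert _ hf.continuous.measurable.ennreal_ofReal hi,
      ofReal_integral_eq_lintegral_ofReal (hdom.integrable_update hw hi z).integrableOn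
        (ae_of_all _ fun r => hdom.nonneg _)]
    refine lintegral_congr fun r => ?_
    rw [← heq]
    -- The measures depend on the base point, but updating coordinate `i ∉ T` does not affect those
    -- indexed by `T`.
    refine congrFun (lmarginal_congr_measure (fun j hj => ?_) _) _
    rw [Function.update_of_ne (by rintro rfl; exact hi hj)]
  suffices h : IsDominated w T (orthantIntegral f T) ∧
      ∀ z, lmarginal (fun i => volume.restrict (Iic (z i))) T (fun y => ENNReal.ofReal (f y)) z =
        ENNReal.ofReal (orthantIntegral f T z) from ⟨h, key T h.1 h.2⟩
  induction T using Finset.induction_on with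
  | empty =>
    rw [orthantIntegral_empty hf.nonneg]
    exact ⟨hf, fun z => by rw [lmarginal_empty]⟩
  | insert i T hi ih =>
    have h := key T ih.1 ih.2 i hi
    have h' : orthantIntegral f (insert i T) =
        fun z => ∫ r in Iic (z i), orthantIntegral f T (Function.update z i r) := by
      funext z
      rw [orthantIntegral, h, ENNReal.toReal_ofReal (integral_nonneg fun r => ih.1.nonneg _)]
    rw [h']
    exact ⟨ih.1.setIntegral_Iic hw hw0 hw1 hi, h⟩

lemma hasDerivAt_orthantIntegral {d : ℕ} {w : ℝ → ℝ} (hw : Integrable w) (hw0 : ∀ r, 0 ≤ w r)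
    (hw1 : ∀ r, w r ≤ 1) {f : (Fin d → ℝ) → ℝ} (hf : IsDominated w ∅ f) {T : Finset (Fin d)}
    {i : Fin d} (hi : i ∉ T) (z : Fin d → ℝ) :
    HasDerivAt (fun s => orthantIntegral f (insert i T) (Function.update z i s))
      (orthantIntegral f T z) (z i) := by
  obtain ⟨⟨hdom, -⟩, hins⟩ := orthantIntegral_spec hw hw0 hw1 hf T
  have h : (fun s => orthantIntegral f (insert i T) (Function.update z i s)) =
      fun s => ∫ r in Iic s, orthantIntegral f T (Function.update z i r) := by
    funext s
    rw [orthantIntegral, hins i hi,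
      ENNReal.toReal_ofReal (integral_nonneg fun r => hdom.nonneg _)]
    simp
  rw [h]
  simpa using hasDerivAt_setIntegral_Iic (hdom.integrable_update hw hi z)
    (hdom.continuous_update z i) (z i)

lemma orthantIntegral_univ {d : ℕ} {f : (Fin d → ℝ) → ℝ} (hf : ∀ z, 0 ≤ f z)
    (hc : Continuous f) (z : Fin d → ℝ) :
    orthantIntegral f Finset.univ z = ∫ y in {y : Fin d → ℝ | ∀ i, y i ≤ z i}, f y := by
  have hset : {y : Fin d → ℝ | ∀ i, y i ≤ z i} = Set.pi univ fun i => Iic (z i) := by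
    ext y
    simp [Pi.le_def]
  rw [orthantIntegral, lmarginal_univ, hset, volume_pi, Measure.restrict_pi_pi,
    integral_eq_lintegral_of_nonneg_ae (ae_of_all _ hf) hc.aestronglyMeasurable]

/-! ### The Gaussian density -/

lemma gaussianDensity_nonneg {d : ℕ} (R : Matrix (Fin d) (Fin d) ℝ) (z : Fin d → ℝ) :
    0 ≤ gaussianDensity R z :=
  mul_nonneg (inv_nonneg.2 (Real.sqrt_nonneg _)) (Real.exp_nonneg _)

lemma continuous_gaussianDensity {d : ℕ} (R : Matrix (Fin d) (Fin d) ℝ) :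
    Continuous (gaussianDensity R) := by
  unfold gaussianDensity
  refine continuous_const.mul (Real.continuous_exp.comp ?_)
  refine (Continuous.neg ?_).div_const _
  exact continuous_id.dotProduct (continuous_const.matrix_mulVec continuous_id)

/-- Both sides are homogeneous of degree two, so it suffices to compare them on the compact sup-norm
sphere: `c` is the minimum of the form there over the maximum of `z ⬝ᵥ z`. -/
lemma _root_.Matrix.PosDef.exists_mul_dotProduct_le {d : ℕ} {A : Matrix (Fin d) (Fin d) ℝ}
    (hA : A.PosDef) : ∃ c, 0 < c ∧ ∀ z : Fin d → ℝ, c * (z ⬝ᵥ z) ≤ z ⬝ᵥ A.mulVec z := by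
  have hcont : Continuous fun z : Fin d → ℝ => z ⬝ᵥ A.mulVec z :=
    continuous_id.dotProduct (continuous_const.matrix_mulVec continuous_id)
  have hnorm : Continuous fun z : Fin d → ℝ => z ⬝ᵥ z := continuous_id.dotProduct continuous_id
  -- The sphere is empty when `d = 0`.
  rcases (Metric.sphere (0 : Fin d → ℝ) 1).eq_empty_or_nonempty with he | hne
  · refine ⟨1, one_pos, fun z => ?_⟩
    have : z = 0 := by
      by_contra hz
      have : ‖z‖⁻¹ • z ∈ Metric.sphere (0 : Fin d → ℝ) 1 := by
        simp [norm_smul, hz]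
      rw [he] at this
      exact this
    simp [this]
  obtain ⟨a, ha, hmin⟩ := (isCompact_sphere (0 : Fin d → ℝ) 1).exists_isMinOn hne hcont.continuousOn
  obtain ⟨b, hb, hmax⟩ := (isCompact_sphere (0 : Fin d → ℝ) 1).exists_isMaxOn hne hnorm.continuousOn
  have hpos : ∀ z : Fin d → ℝ, z ∈ Metric.sphere (0 : Fin d → ℝ) 1 → 0 < z ⬝ᵥ A.mulVec z :=
    fun z hz => hA.dotProduct_mulVec_pos (by rintro rfl; simp at hz)
  have hb0 : 0 < b ⬝ᵥ b := by
    have : b ≠ 0 := by rintro rfl; simp at hb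
    have h := Matrix.PosDef.one.dotProduct_mulVec_pos this
    rwa [Matrix.one_mulVec] at h
  refine ⟨(a ⬝ᵥ A.mulVec a) / (b ⬝ᵥ b), div_pos (hpos a ha) hb0, fun z => ?_⟩
  by_cases hz : z = 0
  · simp [hz]
  have hz' : 0 < ‖z‖ := norm_pos_iff.2 hz
  have hs : ‖z‖⁻¹ • z ∈ Metric.sphere (0 : Fin d → ℝ) 1 := by simp [norm_smul, hz]
  have h1 := hmin hs
  have h2 := hmax hs
  simp only [mem_ofPred_eq, Matrix.mulVec_smul, smul_dotProduct, dotProduct_smul,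
    smul_eq_mul] at h1 h2
  have h3 : ‖z‖⁻¹ * (‖z‖⁻¹ * (z ⬝ᵥ z)) * ((a ⬝ᵥ A.mulVec a) / (b ⬝ᵥ b)) ≤
      ‖z‖⁻¹ * (‖z‖⁻¹ * (z ⬝ᵥ A.mulVec z)) := by
    refine le_trans ?_ h1
    rw [← mul_div_assoc, div_le_iff₀ hb0, mul_comm]
    exact mul_le_mul_of_nonneg_left h2 (hpos a ha).le
  have h4 := mul_le_mul_of_nonneg_left h3 (mul_pos hz' hz').le
  field_simp at h4
  field_simp
  linarith

lemma exists_isDominated_gaussianDensity {d : ℕ} {R : Matrix (Fin d) (Fin d) ℝ} (hR : R.PosDef) :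
    ∃ c, 0 < c ∧ IsDominated (fun r => Real.exp (-c * r ^ 2)) ∅ (gaussianDensity R) := by
  obtain ⟨c, hc, hle⟩ := hR.inv.exists_mul_dotProduct_le
  refine ⟨c / 2, by positivity, continuous_gaussianDensity R, gaussianDensity_nonneg R,
    (Real.sqrt ((2 * Real.pi) ^ d * R.det))⁻¹, inv_nonneg.2 (Real.sqrt_nonneg _), fun z => ?_⟩
  rw [gaussianDensity]
  refine mul_le_mul_of_nonneg_left ?_ (inv_nonneg.2 (Real.sqrt_nonneg _))
  rw [← Real.exp_sum, Real.exp_le_exp]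
  have := hle z
  have hs : ∑ i ∈ (∅ : Finset (Fin d))ᶜ, -(c / 2) * z i ^ 2 = -(c * (z ⬝ᵥ z)) / 2 := by
    simp only [Finset.compl_empty, dotProduct, Finset.mul_sum, Finset.sum_div, neg_div,
      ← Finset.sum_neg_distrib]
    exact Finset.sum_congr rfl fun i _ => by ring
  rw [hs]
  linarith

/-! ### The copula density as the mixed partial derivative of the copula -/

lemma gaussianCopula_eq_orthantIntegral {d : ℕ} (R : Matrix (Fin d) (Fin d) ℝ) {u : Fin d → ℝ}
    (hu : ∀ i, u i ∈ Ioo (0 : ℝ) 1) :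
    gaussianCopula R u =
      orthantIntegral (gaussianDensity R) Finset.univ (fun i => score (u i)) := by
  rw [orthantIntegral_univ (gaussianDensity_nonneg R) (continuous_gaussianDensity R),
    gaussianCopula, gaussianCdf]
  simp only [probit_eq_score (hu _), EReal.coe_le_coe_iff]

/-- Each derivative undoes the integration over its coordinate and, by the chain rule through
`score`, contributes a factor `1/φ`. -/
lemma foldr_partialDeriv_gaussianCopula {d : ℕ} {R : Matrix (Fin d) (Fin d) ℝ} (hR : R.PosDef)
    (l : List (Fin d)) (hl : l.Nodup) {u : Fin d → ℝ} (hu : ∀ i, u i ∈ Ioo (0 : ℝ) 1) :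
    l.foldr partialDeriv (gaussianCopula R) u =
      orthantIntegral (gaussianDensity R) l.toFinsetᶜ (fun i => score (u i)) *
        ∏ i ∈ l.toFinset, (gaussianPDFReal 0 1 (score (u i)))⁻¹ := by
  obtain ⟨c, hc, hdom⟩ := exists_isDominated_gaussianDensity hR
  induction l generalizing u with
  | nil => simp [gaussianCopula_eq_orthantIntegral R hu]
  | cons i l ih =>
    rw [List.nodup_cons] at hl
    have hi : i ∉ l.toFinset := by simpa using hl.1
    have hins : l.toFinsetᶜ = insert i (i :: l).toFinsetᶜ := by
      ext j
      by_cases hj : j = i <;> simp [hj, hl.1]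
    rw [List.foldr_cons, partialDeriv]
    -- A derivative needs the induction hypothesis on a neighbourhood, which is available because
    -- the cube is open.
    have hev : (fun s => l.foldr partialDeriv (gaussianCopula R) (Function.update u i s)) =ᶠ[𝓝 (u i)]
        fun s => orthantIntegral (gaussianDensity R) (insert i (i :: l).toFinsetᶜ)
          (Function.update (fun j => score (u j)) i (score s)) *
            ∏ j ∈ l.toFinset, (gaussianPDFReal 0 1 (score (u j)))⁻¹ := by
      filter_upwards [Ioo_mem_nhds (hu i).1 (hu i).2] with s hs
      have hus : ∀ j, Function.update u i s j ∈ Ioo (0 : ℝ) 1 := by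
        intro j
        by_cases hj : j = i
        · subst hj; simpa using hs
        · simpa [hj] using hu j
      rw [ih hl.2 hus, hins]
      congr 1
      · congr 1
        funext j
        by_cases hj : j = i
        · subst hj; simp
        · simp [hj]
      · refine Finset.prod_congr rfl fun j hj => ?_
        rw [Function.update_of_ne (by rintro rfl; exact hi hj)]
    rw [hev.deriv_eq]
    have hint : Integrable fun r : ℝ => Real.exp (-c * r ^ 2) := integrable_exp_neg_mul_sq hc
    have hd := hasDerivAt_orthantIntegral hint (fun r => (Real.exp_nonneg _))
      (fun r => Real.exp_le_one_iff.2 (by nlinarith [sq_nonneg r])) hdom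
      (T := (i :: l).toFinsetᶜ) (i := i) (by simp) (fun j => score (u j))
    have hd' := (HasDerivAt.comp (u i) hd (hasDerivAt_score (hu i))).mul_const
      (∏ j ∈ l.toFinset, (gaussianPDFReal 0 1 (score (u j)))⁻¹)
    refine (HasDerivAt.deriv hd').trans ?_
    rw [List.toFinset_cons, Finset.prod_insert hi, mul_assoc]

lemma mixedPartial_gaussianCopula {d : ℕ} {R : Matrix (Fin d) (Fin d) ℝ} (hR : R.PosDef)
    {u : Fin d → ℝ} (hu : ∀ i, u i ∈ Ioo (0 : ℝ) 1) :
    mixedPartial Finset.univ (gaussianCopula R) u = gaussianCopulaDensity R u := by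
  rw [mixedPartial, foldr_partialDeriv_gaussianCopula hR _ (Finset.sort_nodup _ _) hu,
    Finset.sort_toFinset, Finset.compl_univ, orthantIntegral_empty (gaussianDensity_nonneg R),
    gaussianCopulaDensity, div_eq_mul_inv]
  congr 1
  -- What remains is that the product of the univariate normal densities is the density with
  -- identity covariance.
  rw [Finset.prod_inv_distrib]
  congr 1
  simp only [gaussianDensity, gaussianPDFReal, Finset.prod_mul_distrib, Matrix.det_one,
    Finset.prod_const, Finset.card_univ, Fintype.card_fin, ← Real.exp_sum, inv_one,
    Matrix.one_mulVec]
  congr 1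
  · rw [inv_pow, mul_one, NNReal.coe_one, mul_one]
    congr 1
    symm
    rw [Real.sqrt_eq_iff_eq_sq (by positivity) (by positivity), ← pow_mul, mul_comm d, pow_mul,
      Real.sq_sqrt (by positivity)]
  · congr 1
    simp [dotProduct, Finset.sum_div, neg_div, ← Finset.sum_neg_distrib, sq, score]

/-! ### Compactness of sets of positive semidefinite matrices -/

/-- Test the form on `eᵢ + eⱼ` and `eᵢ - eⱼ`. -/
lemma _root_.Matrix.PosSemidef.two_mul_abs_apply_le {d : ℕ} {A : Matrix (Fin d) (Fin d) ℝ}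
    (hA : A.PosSemidef) (i j : Fin d) : 2 * |A i j| ≤ A i i + A j j := by
  have hsym : A j i = A i j := by simpa using hA.isHermitian.apply i j
  have h1 := hA.dotProduct_mulVec_nonneg (Pi.single i 1 + Pi.single j 1)
  have h2 := hA.dotProduct_mulVec_nonneg (Pi.single i 1 - Pi.single j 1)
  simp [Matrix.mulVec_add, Matrix.mulVec_sub, hsym, sub_dotProduct, add_dotProduct] at h1 h2
  rcases abs_cases (A i j) with ⟨h, -⟩ | ⟨h, -⟩ <;> rw [h] <;> linarith

lemma isClosed_posSemidef (d : ℕ) : IsClosed {A : Matrix (Fin d) (Fin d) ℝ | A.PosSemidef} := by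
  simp only [Matrix.posSemidef_iff_dotProduct_mulVec, ofPred_and, ofPred_forall]
  refine IsClosed.inter ?_ (isClosed_iInter fun x => ?_)
  · exact isClosed_eq continuous_id.matrix_conjTranspose continuous_id
  · exact isClosed_le continuous_const
      (continuous_const.dotProduct (continuous_id.matrix_mulVec continuous_const))

lemma isCompact_posSemidef_trace (d : ℕ) (c : ℝ) :
    IsCompact {A : Matrix (Fin d) (Fin d) ℝ | A.PosSemidef ∧ A.trace = c} := by
  have hK : IsCompact (Set.pi univ fun _ : Fin d => Set.pi univ fun _ : Fin d => Icc (-c) c) :=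
    isCompact_univ_pi fun _ => isCompact_univ_pi fun _ => isCompact_Icc
  refine IsCompact.of_isClosed_subset hK ?_ ?_
  · exact (isClosed_posSemidef d).inter (isClosed_eq continuous_id.matrix_trace continuous_const)
  · rintro A ⟨hA, rfl⟩ i - j -
    have hle : ∀ k, A k k ≤ A.trace := fun k =>
      Finset.single_le_sum (f := fun k => A k k) (fun _ _ => hA.diag_nonneg) (Finset.mem_univ k)
    have := hA.two_mul_abs_apply_le i j
    exact abs_le.1 (by linarith [hle i, hle j])

/-- Each eigenvalue is at most the sum of all of them. -/
lemma _root_.Matrix.PosSemidef.det_le_trace_pow {d : ℕ} {A : Matrix (Fin d) (Fin d) ℝ}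
    (hA : A.PosSemidef) : A.det ≤ A.trace ^ d := by
  have htr : A.trace = ∑ i, hA.isHermitian.eigenvalues i := by
    simpa using hA.isHermitian.trace_eq_sum_eigenvalues
  have hdet : A.det = ∏ i, hA.isHermitian.eigenvalues i := by
    simpa using hA.isHermitian.det_eq_prod_eigenvalues
  rw [hdet]
  calc ∏ i, hA.isHermitian.eigenvalues i ≤ ∏ _i : Fin d, A.trace := by
        refine Finset.prod_le_prod (fun i _ => hA.eigenvalues_nonneg i) fun i _ => ?_
        rw [htr]
        exact Finset.single_le_sum (fun i _ => hA.eigenvalues_nonneg i) (Finset.mem_univ i)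
    _ = A.trace ^ d := by simp

/-! ### The profile likelihood of a Gaussian sample -/

/-- The sum over a sample of the values of a quadratic form. -/
def sampleQuad {d N : ℕ} (Z : Fin N → Fin d → ℝ) (A : Matrix (Fin d) (Fin d) ℝ) : ℝ :=
  ∑ t, Z t ⬝ᵥ A.mulVec (Z t)

lemma continuous_sampleQuad (d N : ℕ) :
    Continuous fun q : (Fin N → Fin d → ℝ) × Matrix (Fin d) (Fin d) ℝ => sampleQuad q.1 q.2 := by
  refine continuous_finsetSum _ fun t _ => ?_
  have h : Continuous fun q : (Fin N → Fin d → ℝ) × Matrix (Fin d) (Fin d) ℝ => q.1 t :=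
    (continuous_apply t).comp continuous_fst
  exact h.dotProduct (continuous_snd.matrix_mulVec h)

lemma tendsto_sampleQuad {d N : ℕ} {α : Type*} {l : Filter α} {Zf : α → Fin N → Fin d → ℝ}
    {Af : α → Matrix (Fin d) (Fin d) ℝ} {Z : Fin N → Fin d → ℝ} {A : Matrix (Fin d) (Fin d) ℝ}
    (hZ : Tendsto Zf l (𝓝 Z)) (hA : Tendsto Af l (𝓝 A)) :
    Tendsto (fun a => sampleQuad (Zf a) (Af a)) l (𝓝 (sampleQuad Z A)) := by
  have h := (continuous_sampleQuad d N).tendsto (Z, A)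
  exact Tendsto.comp (g := fun q : (Fin N → Fin d → ℝ) × Matrix (Fin d) (Fin d) ℝ =>
    sampleQuad q.1 q.2) (f := fun a => (Zf a, Af a)) h (hZ.prodMk_nhds hA)

/-- If the sum vanished, each term would, and a positive semidefinite `A` would annihilate a
spanning family. -/
lemma sampleQuad_pos {d N : ℕ} {Z : Fin N → Fin d → ℝ} (hZ : Submodule.span ℝ (range Z) = ⊤)
    {A : Matrix (Fin d) (Fin d) ℝ} (hA : A.PosSemidef) (h0 : A ≠ 0) : 0 < sampleQuad Z A := by
  have hn : ∀ t ∈ Finset.univ, 0 ≤ Z t ⬝ᵥ A.mulVec (Z t) := fun t _ =>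
    hA.dotProduct_mulVec_nonneg (Z t)
  refine (Finset.sum_nonneg hn).lt_of_ne fun h => h0 ?_
  have hker : ∀ t, A.mulVec (Z t) = 0 := fun t =>
    (hA.dotProduct_mulVec_zero_iff (Z t)).1 ((Finset.sum_eq_zero_iff_of_nonneg hn).1 h.symm t
      (Finset.mem_univ t))
  have : A.mulVecLin = 0 := LinearMap.ext_on_range hZ fun t => by simpa using hker t
  exact Matrix.toLin'.injective (by rw [Matrix.toLin'_apply', this, map_zero])

/-- On the compact slice `tr A = 1` the form has a positive lower bound `m`; halving it leaves room
to move `Z`, uniformly in `A` by compactness. Scaling gives the other traces. -/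
lemma exists_eventually_mul_trace_le_sampleQuad {d N : ℕ} {Z : Fin N → Fin d → ℝ}
    (hZ : Submodule.span ℝ (range Z) = ⊤) :
    ∃ ε, 0 < ε ∧ ∀ᶠ Y in 𝓝 Z, ∀ A : Matrix (Fin d) (Fin d) ℝ, A.PosSemidef →
      ε * A.trace ≤ sampleQuad Y A := by
  have hK := isCompact_posSemidef_trace d 1
  obtain ⟨m, hm, hle⟩ := hK.exists_forall_le' (f := sampleQuad Z) (a := 0)
    ((continuous_sampleQuad d N).comp (continuous_const.prodMk continuous_id)).continuousOn
    (fun A hA => sampleQuad_pos hZ hA.1 (by rintro rfl; simpa using hA.2))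
  refine ⟨m / 2, by positivity, ?_⟩
  have hev : ∀ᶠ Y in 𝓝 Z, ∀ A ∈ {A : Matrix (Fin d) (Fin d) ℝ | A.PosSemidef ∧ A.trace = 1},
      m / 2 < sampleQuad Y A :=
    hK.eventually_forall_of_forall_eventually fun A hA =>
      (continuous_sampleQuad d N).continuousAt.eventually
        (lt_mem_nhds ((half_lt_self hm).trans_le (hle A hA)))
  filter_upwards [hev] with Y hY A hA
  rcases hA.trace_nonneg.eq_or_lt with h | h
  · have : A = 0 := hA.trace_eq_zero_iff.1 h.symm
    simp [this, sampleQuad]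
  · have h1 := hY (A.trace⁻¹ • A) ⟨hA.smul (inv_nonneg.2 h.le), by simp [h.ne']⟩
    have h2 : sampleQuad Y (A.trace⁻¹ • A) = A.trace⁻¹ * sampleQuad Y A := by
      simp [sampleQuad, Matrix.smul_mulVec, dotProduct_smul, Finset.mul_sum]
    rw [h2, inv_mul_eq_div, lt_div_iff₀ h] at h1
    exact h1.le

/-- Twice the log-likelihood of a centered Gaussian sample, up to constants. -/
noncomputable def profile {d N : ℕ} (Z : Fin N → Fin d → ℝ) (R : Matrix (Fin d) (Fin d) ℝ) : ℝ :=
  -(N * Real.log R.det) - sampleQuad Z R⁻¹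

lemma tendsto_profile {d N : ℕ} {α : Type*} {l : Filter α} {Zf : α → Fin N → Fin d → ℝ}
    {Rf : α → Matrix (Fin d) (Fin d) ℝ} {Z : Fin N → Fin d → ℝ} {R : Matrix (Fin d) (Fin d) ℝ}
    (hZ : Tendsto Zf l (𝓝 Z)) (hR : Tendsto Rf l (𝓝 R)) (h0 : R.det ≠ 0) :
    Tendsto (fun a => profile (Zf a) (Rf a)) l (𝓝 (profile Z R)) := by
  have hdet : Tendsto (fun a => (Rf a).det) l (𝓝 R.det) :=
    ((continuous_id.matrix_det : Continuous fun A : Matrix (Fin d) (Fin d) ℝ => A.det).tendsto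
      R).comp hR
  have hadj : Tendsto (fun a => (Rf a).adjugate) l (𝓝 R.adjugate) :=
    ((continuous_id.matrix_adjugate :
      Continuous fun A : Matrix (Fin d) (Fin d) ℝ => A.adjugate).tendsto R).comp hR
  have hinv : Tendsto (fun a => (Rf a)⁻¹) l (𝓝 R⁻¹) := by
    -- Adjugate and determinant are polynomial in the entries, so inversion is continuous where the
    -- determinant is nonzero.
    have hi : ∀ A : Matrix (Fin d) (Fin d) ℝ, A⁻¹ = A.det⁻¹ • A.adjugate := fun A => by
      rw [Matrix.inv_def, Ring.inverse_eq_inv']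
    simp_rw [hi]
    exact (hdet.inv₀ h0).smul hadj
  have hquad : Tendsto (fun a => sampleQuad (Zf a) (Rf a)⁻¹) l (𝓝 (sampleQuad Z R⁻¹)) :=
    tendsto_sampleQuad hZ hinv
  exact (((hdet.log h0).const_mul (N : ℝ)).neg).sub hquad

lemma one_mem_corrMatrices (d : ℕ) : (1 : Matrix (Fin d) (Fin d) ℝ) ∈ corrMatrices d :=
  ⟨Matrix.PosDef.one, fun i => Matrix.one_apply_eq i⟩

/-- The bound `δ ≤ det` upgrades positive semidefinite to positive definite, so the open condition
becomes closed. -/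
lemma isCompact_corrMatrices_det {d : ℕ} {δ : ℝ} (hδ : 0 < δ) :
    IsCompact {R | R ∈ corrMatrices d ∧ δ ≤ R.det} := by
  have h : {R | R ∈ corrMatrices d ∧ δ ≤ R.det} =
      {A : Matrix (Fin d) (Fin d) ℝ | A.PosSemidef ∧ A.trace = d} ∩
        {A | (∀ i, A i i = 1) ∧ δ ≤ A.det} := by
    ext A
    constructor
    · rintro ⟨⟨h1, h2⟩, h3⟩
      exact ⟨⟨h1.posSemidef, by simp [Matrix.trace, h2]⟩, h2, h3⟩
    · rintro ⟨⟨h1, -⟩, h2, h3⟩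
      refine ⟨⟨?_, h2⟩, h3⟩
      rw [h1.posDef_iff_isUnit, Matrix.isUnit_iff_isUnit_det]
      exact (hδ.trans_le h3).ne'.isUnit
  rw [h]
  refine (isCompact_posSemidef_trace d d).inter_right ?_
  simp only [ofPred_and, ofPred_forall]
  exact (isClosed_iInter fun i => isClosed_eq (continuous_id.matrix_elem i i)
    continuous_const).inter (isClosed_le continuous_const continuous_id.matrix_det)

/-- Coercivity: the linear penalty `ε tr R⁻¹` beats the logarithmic gain from a small determinant.
-/
lemma exists_eventually_profile_lt {d N : ℕ} {Z : Fin N → Fin d → ℝ}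
    (hZ : Submodule.span ℝ (range Z) = ⊤) :
    ∃ δ : ℝ, 0 < δ ∧ δ ≤ 1 ∧ ∀ᶠ Y in 𝓝 Z, ∀ R ∈ corrMatrices d, R.det < δ →
      profile Y R < profile Y 1 := by
  obtain ⟨ε, hε, hquad⟩ := exists_eventually_mul_trace_le_sampleQuad hZ
  have hlim : Tendsto (fun τ : ℝ => N * (d * Real.log τ) - ε * τ) atTop atBot := by
    have ho : (fun τ : ℝ => (N * d : ℝ) * Real.log τ) =o[atTop] (id : ℝ → ℝ) :=
      Real.isLittleO_log_id_atTop.const_mul_left _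
    refine tendsto_atBot_mono' _ ?_ (tendsto_id.const_mul_atTop_of_neg (r := -(ε / 2))
      (by linarith))
    filter_upwards [ho.bound (half_pos hε), eventually_ge_atTop 0] with τ hτ h0
    rw [id, Real.norm_of_nonneg h0] at hτ
    have := (le_abs_self _).trans hτ
    simp only [id]
    linarith
  -- Beyond `T` the upper bound falls below `-(sampleQuad Z 1 + 1)`, itself below `profile Y 1` for
  -- `Y` near `Z`. Taking `T ≥ 1` gives `δ ≤ 1`, so that the identity satisfies `δ ≤ det`.
  obtain ⟨T, hT1, hT⟩ := ((eventually_ge_atTop (1 : ℝ)).and (eventually_forall_ge_atTop.2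
    (hlim.eventually (eventually_lt_atBot (-(sampleQuad Z 1 + 1)))))).exists
  have hT0 : 0 < T := by linarith
  have hone : ∀ᶠ Y in 𝓝 Z, sampleQuad Y 1 < sampleQuad Z 1 + 1 :=
    ((continuous_sampleQuad d N).comp (continuous_id.prodMk continuous_const)).continuousAt.eventually
      (gt_mem_nhds (by simp))
  -- With this `δ`, `det R < δ` forces `T ^ d < det R⁻¹ ≤ (tr R⁻¹) ^ d`.
  refine ⟨(T ^ d)⁻¹, by positivity, inv_le_one_of_one_le₀ (one_le_pow₀ hT1), ?_⟩
  filter_upwards [hquad, hone] with Y hY hY1 R hR hdet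
  have hdet0 : 0 < R.det := hR.1.det_pos
  have hA := hR.1.inv.posSemidef
  have hle := hA.det_le_trace_pow
  have hdinv : R⁻¹.det = R.det⁻¹ := by rw [Matrix.det_nonsing_inv, Ring.inverse_eq_inv']
  rw [hdinv] at hle
  have hpow : T ^ d < R⁻¹.trace ^ d := by
    refine lt_of_lt_of_le ?_ hle
    rw [lt_inv_comm₀ (by positivity) hdet0]
    exact hdet
  have htr : T < R⁻¹.trace := lt_of_pow_lt_pow_left₀ d hA.trace_nonneg hpow
  have hlog : -Real.log R.det ≤ d * Real.log R⁻¹.trace := by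
    rw [← Real.log_inv, ← Real.log_pow]
    exact Real.log_le_log (inv_pos.2 hdet0) hle
  have h1 := hT _ htr.le
  have h2 := hY _ hA
  have h3 := mul_le_mul_of_nonneg_left hlog (Nat.cast_nonneg (α := ℝ) N)
  simp only [profile, Matrix.det_one, Real.log_one, inv_one]
  linarith

/-! ### Upper semicontinuity of the set of maximizers -/

lemma mem_argmaxCorr_profile_iff {d N : ℕ} {Z : Fin N → Fin d → ℝ} {R : Matrix (Fin d) (Fin d) ℝ} :
    R ∈ argmaxCorr (fun R => (profile Z R : EReal)) ↔
      R ∈ corrMatrices d ∧ ∀ R' ∈ corrMatrices d, profile Z R' ≤ profile Z R := by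
  simp [argmaxCorr]

lemma eventually_argmaxCorr_profile_nonempty {d N : ℕ} {Z : Fin N → Fin d → ℝ}
    (hZ : Submodule.span ℝ (range Z) = ⊤) :
    ∀ᶠ Y in 𝓝 Z, (argmaxCorr fun R => (profile Y R : EReal)).Nonempty := by
  obtain ⟨δ, hδ, hδ1, hev⟩ := exists_eventually_profile_lt hZ
  filter_upwards [hev] with Y hY
  have h1 : (1 : Matrix (Fin d) (Fin d) ℝ) ∈ {R | R ∈ corrMatrices d ∧ δ ≤ R.det} :=
    ⟨one_mem_corrMatrices d, by simpa using hδ1⟩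
  obtain ⟨R, hR, hmax⟩ := (isCompact_corrMatrices_det hδ).exists_isMaxOn ⟨1, h1⟩
    (f := profile Y) fun R hR => 
      ContinuousAt.continuousWithinAt
        (tendsto_profile tendsto_const_nhds tendsto_id (hδ.trans_le hR.2).ne')
  refine ⟨R, mem_argmaxCorr_profile_iff.2 ⟨hR.1, fun R' hR' => ?_⟩⟩
  rcases lt_or_ge R'.det δ with h | h
  · exact (hY R' hR' h).le.trans (hmax h1)
  · exact hmax ⟨hR', h⟩

/-- Off `V`, a matrix with `det R ≥ δ` loses strictly at `Z` to a fixed maximizer `M`. The strict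
inequality is open in `(Y, R)`, hence uniform in `R` by compactness. Matrices with smaller
determinant lose to the identity. -/
lemma eventually_argmaxCorr_profile_subset {d N : ℕ} {Z : Fin N → Fin d → ℝ}
    (hZ : Submodule.span ℝ (range Z) = ⊤) {V : Set (Matrix (Fin d) (Fin d) ℝ)} (hV : IsOpen V)
    (hsub : (argmaxCorr fun R => (profile Z R : EReal)) ⊆ V) :
    ∀ᶠ Y in 𝓝 Z, (argmaxCorr fun R => (profile Y R : EReal)) ⊆ V := by
  obtain ⟨δ, hδ, -, hev⟩ := exists_eventually_profile_lt hZ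
  obtain ⟨M, hM⟩ := (eventually_argmaxCorr_profile_nonempty hZ).self_of_nhds
  rw [mem_argmaxCorr_profile_iff] at hM
  have hK : IsCompact ({R | R ∈ corrMatrices d ∧ δ ≤ R.det} ∩ Vᶜ) :=
    (isCompact_corrMatrices_det hδ).inter_right hV.isClosed_compl
  have hlt : ∀ᶠ Y in 𝓝 Z, ∀ R ∈ {R | R ∈ corrMatrices d ∧ δ ≤ R.det} ∩ Vᶜ,
      profile Y R < profile Y M := by
    refine hK.eventually_forall_of_forall_eventually fun R hR => ?_
    have hRM : profile Z R < profile Z M := by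
      by_contra! h
      exact hR.2 (hsub (mem_argmaxCorr_profile_iff.2 ⟨hR.1.1, fun R' hR' => (hM.2 R' hR').trans h⟩))
    exact (tendsto_profile (l := 𝓝 (Z, R)) continuousAt_fst continuousAt_snd
      hR.1.1.1.det_pos.ne').eventually_lt (tendsto_profile (l := 𝓝 (Z, R)) continuousAt_fst
      tendsto_const_nhds hM.1.1.det_pos.ne') hRM
  filter_upwards [hev, hlt] with Y hY hY' R hR
  rw [mem_argmaxCorr_profile_iff] at hR
  by_contra hRV
  rcases lt_or_ge R.det δ with h | h
  · exact absurd (hR.2 1 (one_mem_corrMatrices d)) (not_le.2 (hY R hR.1 h))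
  · exact absurd (hR.2 M hM.1) (not_le.2 (hY' R ⟨⟨hR.1, h⟩, hRV⟩))

lemma argmaxCorr_eq_of_eq_profile {d N : ℕ} {Z : Fin N → Fin d → ℝ} {c : ℝ}
    {L : Matrix (Fin d) (Fin d) ℝ → EReal}
    (hL : ∀ R ∈ corrMatrices d, L R = ((profile Z R / 2 + c : ℝ) : EReal)) :
    argmaxCorr L = argmaxCorr fun R => (profile Z R : EReal) := by
  ext R
  refine and_congr_right fun hR => forall₂_congr fun R' hR' => ?_
  rw [hL R hR, hL R' hR', EReal.coe_le_coe_iff, EReal.coe_le_coe_iff, add_le_add_iff_right,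
    div_le_div_iff_of_pos_right two_pos]

/-- The additive constant may vary with `p`, since it does not move the argmax. -/
lemma maximizersConverge_of_profile {d N : ℕ} {Z : Fin N → Fin d → ℝ}
    (hZ : Submodule.span ℝ (range Z) = ⊤) {Zp : (Fin d → ℝ) → Fin N → Fin d → ℝ}
    (hlim : Tendsto Zp (toOne d) (𝓝 Z)) {Lp : (Fin d → ℝ) → Matrix (Fin d) (Fin d) ℝ → EReal}
    {L : Matrix (Fin d) (Fin d) ℝ → EReal}
    (hLp : ∀ᶠ p in toOne d, ∃ c : ℝ, ∀ R ∈ corrMatrices d,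
      Lp p R = ((profile (Zp p) R / 2 + c : ℝ) : EReal))
    (hL : ∃ c : ℝ, ∀ R ∈ corrMatrices d, L R = ((profile Z R / 2 + c : ℝ) : EReal)) :
    MaximizersConverge Lp L := by
  obtain ⟨c, hc⟩ := hL
  have hsub : ∀ V : Set (Matrix (Fin d) (Fin d) ℝ), IsOpen V → argmaxCorr L ⊆ V →
      ∀ᶠ p in toOne d, argmaxCorr (Lp p) ⊆ V := by
    intro V hV hLV
    rw [argmaxCorr_eq_of_eq_profile hc] at hLV
    filter_upwards [hLp, hlim.eventually (eventually_argmaxCorr_profile_subset hZ hV hLV)]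
      with p ⟨c', hc'⟩ hp
    rwa [argmaxCorr_eq_of_eq_profile hc']
  refine ⟨?_, ?_, hsub, fun ρ r hρ hr => ?_⟩
  · rw [argmaxCorr_eq_of_eq_profile hc]
    exact (eventually_argmaxCorr_profile_nonempty hZ).self_of_nhds
  · filter_upwards [hLp, hlim.eventually (eventually_argmaxCorr_profile_nonempty hZ)]
      with p ⟨c', hc'⟩ hp
    rwa [argmaxCorr_eq_of_eq_profile hc']
  · rw [tendsto_nhds]
    intro V hV hρV
    filter_upwards [hsub V hV (by rw [hρ]; exact singleton_subset_iff.2 hρV), hr] with p hp hrp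
      using hp hrp

/-! ### Severity distribution functions -/

namespace SeverityFamily

variable {Θ : Type*} (F : SeverityFamily Θ)

lemma setIntegral_pdf_pos (θ : Θ) {s : Set ℝ} (hs : MeasurableSet s) (hs0 : s ⊆ Ioi 0) {a b : ℝ}
    (hab : a < b) (hsub : Ioo a b ⊆ s) (hpos : ∀ y ∈ Ioo a b, 0 < F.pdf θ y) :
    0 < ∫ y in s, F.pdf θ y := by
  rw [setIntegral_pos_iff_support_of_nonneg_ae
    ((ae_restrict_iff' hs).2 (ae_of_all _ fun y hy => F.pdf_nonneg θ y (hs0 hy)))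
    ((F.integrableOn_pdf θ).mono_set hs0)]
  refine lt_of_lt_of_le ?_ (measure_mono (s := Ioo a b) fun y hy => ⟨(hpos y hy).ne', hsub hy⟩)
  simpa using hab

/-- By continuity the density is positive around `x`, so there is mass on both sides of `x`. -/
lemma cdf_mem_Ioo {θ : Θ} {x : ℝ} (hx : 0 < x) (hpos : 0 < F.pdf θ x) :
    F.cdf θ x ∈ Ioo (0 : ℝ) 1 := by
  have hev : ∀ᶠ y in 𝓝 x, 0 < y ∧ 0 < F.pdf θ y :=
    (lt_mem_nhds hx).and (((F.continuousOn_pdf θ).continuousAt (Ioi_mem_nhds hx)).eventually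
      (lt_mem_nhds hpos))
  obtain ⟨l, r, hlr, hsub⟩ := mem_nhds_iff_exists_Ioo_subset.1 hev
  constructor
  · exact F.setIntegral_pdf_pos θ measurableSet_Ioc (fun y hy => hy.1) hlr.1
      (fun y hy => ⟨(hsub ⟨hy.1, hy.2.trans hlr.2⟩).1, hy.2.le⟩)
      fun y hy => (hsub ⟨hy.1, hy.2.trans hlr.2⟩).2
  · have h := F.setIntegral_pdf_pos θ (s := Ioi x) measurableSet_Ioi (Ioi_subset_Ioi hx.le) hlr.2
      (fun y hy => hy.1) fun y hy => (hsub ⟨hlr.1.trans hy.1, hy.2⟩).2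
    have hu := setIntegral_union (f := F.pdf θ) (μ := volume)
      (Ioc_disjoint_Ioi_same (a := (0 : ℝ)) (b := x))
      measurableSet_Ioi ((F.integrableOn_pdf θ).mono_set fun y hy => hy.1)
      ((F.integrableOn_pdf θ).mono_set (Ioi_subset_Ioi hx.le))
    rw [Ioc_union_Ioi_eq_Ioi hx.le, F.integral_pdf θ] at hu
    rw [SeverityFamily.cdf]
    linarith

lemma monotone_cdf (θ : Θ) : Monotone (F.cdf θ) := fun _ _ hxy =>
  setIntegral_mono_set ((F.integrableOn_pdf θ).mono_set fun _ hz => hz.1)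
    ((ae_restrict_iff' measurableSet_Ioc).2 (ae_of_all _ fun z hz => F.pdf_nonneg θ z hz.1))
    (Ioc_subset_Ioc_right hxy).eventuallyLE

lemma continuousAt_cdf (θ : Θ) {x : ℝ} (hx : 0 < x) : ContinuousAt (F.cdf θ) x := by
  have h : IntegrableOn (F.pdf θ) (Icc 0 (x + 1)) := by
    rw [integrableOn_Icc_iff_integrableOn_Ioc]
    exact (F.integrableOn_pdf θ).mono_set fun _ hz => hz.1
  exact (intervalIntegral.continuousOn_primitive h).continuousAt (Icc_mem_nhds hx (lt_add_one x))

/-- Monotonicity sandwiches the value at the moving point between values at fixed points on either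
side of `x`, and continuity of the limit closes the gap. -/
lemma tendsto_cdf {α : Type*} {l : Filter α} {θf : α → Θ} {θ : Θ} {xf : α → ℝ} {x : ℝ} (hx : 0 < x)
    (hxf : Tendsto xf l (𝓝 x))
    (hcdf : ∀ y, 0 < y → Tendsto (fun a => F.cdf (θf a) y) l (𝓝 (F.cdf θ y))) :
    Tendsto (fun a => F.cdf (θf a) (xf a)) l (𝓝 (F.cdf θ x)) := by
  have hc := F.continuousAt_cdf θ hx
  refine tendsto_order.2 ⟨fun b hb => ?_, fun b hb => ?_⟩
  -- The left comparison point must stay positive, where pointwise convergence is assumed.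
  · have hev := ((hc.eventually (lt_mem_nhds hb)).and (lt_mem_nhds hx)).filter_mono
      (nhdsWithin_le_nhds (s := Iio x))
    obtain ⟨y, ⟨hby, hy⟩, hyx⟩ := (hev.and self_mem_nhdsWithin).exists
    filter_upwards [(hcdf y hy).eventually (lt_mem_nhds hby), hxf.eventually (lt_mem_nhds hyx)]
      with a ha hxa using ha.trans_le (F.monotone_cdf _ (le_of_lt hxa))
  · have hev := (hc.eventually (gt_mem_nhds hb)).filter_mono (nhdsWithin_le_nhds (s := Ioi x))
    obtain ⟨y, hby, hyx⟩ := (hev.and self_mem_nhdsWithin).exists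
    filter_upwards [(hcdf y (hx.trans hyx)).eventually (gt_mem_nhds hby),
      hxf.eventually (gt_mem_nhds hyx)]
      with a ha hxa using (F.monotone_cdf _ (le_of_lt hxa)).trans_lt ha

end SeverityFamily

lemma marginalCdf_one {Θ : Type*} (F : SeverityFamily Θ) (θ : Θ) (x : ℝ) :
    marginalCdf F 1 θ x = F.cdf θ x := by
  rcases le_or_gt x 0 with h | h
  · simp [marginalCdf, SeverityFamily.cdf, Ioc_eq_empty_of_le h]
  · simp [marginalCdf, h]

lemma marginalCdf_of_pos {Θ : Type*} (F : SeverityFamily Θ) (p : ℝ) (θ : Θ) {x : ℝ} (hx : 0 < x) :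
    marginalCdf F p θ x = 1 - p + p * F.cdf θ x := by
  simp [marginalCdf, hx, hx.le]

/-! ### Positivity of the full sample and of its true and fitted severity densities -/

/-- For `p = 1` each component has law with density `pdf` on `(0, ∞)`, and a law does not charge the
zeros of its density. -/
lemma IsSample.ae_pos {Ω : Type*} [MeasurableSpace Ω] {μ : Measure Ω} [IsProbabilityMeasure μ]
    {d N : ℕ} {Θ : Fin d → Type*} {F : ∀ i, SeverityFamily (Θ i)} {θ : ∀ i, Θ i}
    {R : Matrix (Fin d) (Fin d) ℝ} {X : Fin N → Ω → Fin d → ℝ} (hX : IsSample μ F 1 θ R X) :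
    ∀ᵐ ω ∂μ, ∀ t i, 0 < X t ω i ∧ 0 < (F i).pdf (θ i) (X t ω i) := by
  refine ae_all_iff.2 fun t => ae_all_iff.2 fun i => ?_
  have hm : Measurable fun ω => X t ω i := (measurable_pi_apply i).comp (hX.measurable t)
  have hint := (F i).integrableOn_pdf (θ i)
  have hnn : ∀ᵐ y ∂(volume.restrict (Ioi (0 : ℝ))), 0 ≤ (F i).pdf (θ i) y :=
    (ae_restrict_iff' measurableSet_Ioi).2 (ae_of_all _ fun y hy => (F i).pdf_nonneg _ y hy)
  have hmap : μ.map (fun ω => X t ω i) = (volume.restrict (Ioi (0 : ℝ))).withDensity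
      fun y => ENNReal.ofReal ((F i).pdf (θ i) y) := by
    have : IsProbabilityMeasure (μ.map fun ω => X t ω i) :=
      Measure.isProbabilityMeasure_map hm.aemeasurable
    refine Measure.ext_of_Iic _ _ fun x => ?_
    have h := hX.marginal t i x
    rw [Pi.one_apply, marginalCdf_one] at h
    have hset : {ω | X t ω i ≤ x} = (fun ω => X t ω i) ⁻¹' Iic x := rfl
    rw [Measure.map_apply hm measurableSet_Iic, withDensity_apply _ measurableSet_Iic,
      Measure.restrict_restrict measurableSet_Iic, inter_comm, Ioi_inter_Iic,
      ← ofReal_integral_eq_lintegral_ofReal (hint.mono_set fun _ hz => hz.1)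
        (ae_restrict_of_ae_restrict_of_subset (fun _ hz => hz.1) hnn), ← hset,
      ← ofReal_measureReal, h]
    rfl
  refine ae_of_ae_map (p := fun y => 0 < y ∧ 0 < (F i).pdf (θ i) y) hm.aemeasurable ?_
  rw [hmap, ae_withDensity_iff' hint.aestronglyMeasurable.aemeasurable.ennreal_ofReal]
  filter_upwards [ae_restrict_mem measurableSet_Ioi] with y hy hy'
  exact ⟨hy, by simpa using hy'⟩

/-- The competitor `(1, θ₀)` has positive likelihood, so no factor of the maximal one can vanish. -/
lemma IsMarginalMLE.pdf_pos {Θ : Type*} {N : ℕ} {F : SeverityFamily Θ} {x : Fin N → ℝ} {p : ℝ}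
    {θ θ₀ : Θ} (h : IsMarginalMLE F x p θ) (hx : ∀ t, 0 < x t) (h0 : ∀ t, 0 < F.pdf θ₀ (x t))
    (t : Fin N) : 0 < F.pdf θ (x t) := by
  have hle := h.2 1 ⟨one_pos, le_rfl⟩ θ₀
  simp only [marginalLikelihood, hx, if_true, one_mul] at hle
  have hpos := (Finset.prod_pos fun t _ => h0 t).trans_le hle
  refine (F.pdf_nonneg θ _ (hx t)).lt_of_ne fun hz => hpos.ne' ?_
  exact Finset.prod_eq_zero (Finset.mem_univ t) (by rw [← hz, mul_zero])

/-- With no zeros in the sample, `p` enters only through `p ^ N`; for `N = 0` every `p` would be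
optimal. -/
lemma IsMarginalMLE.eq_one {Θ : Type*} {N : ℕ} {F : SeverityFamily Θ} {x : Fin N → ℝ} {p : ℝ}
    {θ θ₀ : Θ} (h : IsMarginalMLE F x p θ) (hx : ∀ t, 0 < x t) (h0 : ∀ t, 0 < F.pdf θ₀ (x t))
    (hN : N ≠ 0) : p = 1 := by
  have hle := h.2 1 ⟨one_pos, le_rfl⟩ θ
  simp only [marginalLikelihood, hx, if_true, one_mul, Finset.prod_mul_distrib, Finset.prod_const,
    Finset.card_univ, Fintype.card_fin] at hle
  have hpos : 0 < ∏ t, F.pdf θ (x t) := Finset.prod_pos fun t _ => h.pdf_pos hx h0 t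
  have h1 : 1 ≤ p ^ N := by
    by_contra! hlt
    nlinarith
  by_contra hne
  exact absurd h1 (not_le.2 (pow_lt_one₀ h.1.1.le (h.1.2.lt_of_ne hne) hN))

/-! ### The likelihood in terms of the normal scores -/

lemma gaussianDensity_pos {d : ℕ} {R : Matrix (Fin d) (Fin d) ℝ} (hR : R.PosDef)
    (z : Fin d → ℝ) : 0 < gaussianDensity R z := by
  have := hR.det_pos
  unfold gaussianDensity
  positivity

lemma gaussianCopulaDensity_pos {d : ℕ} {R : Matrix (Fin d) (Fin d) ℝ} (hR : R.PosDef)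
    (u : Fin d → ℝ) : 0 < gaussianCopulaDensity R u :=
  div_pos (gaussianDensity_pos hR _) (gaussianDensity_pos Matrix.PosDef.one _)

lemma log_gaussianDensity {d : ℕ} {R : Matrix (Fin d) (Fin d) ℝ} (hR : R.PosDef)
    (z : Fin d → ℝ) :
    Real.log (gaussianDensity R z) =
      -(Real.log ((2 * Real.pi) ^ d) + Real.log R.det) / 2 - (z ⬝ᵥ R⁻¹.mulVec z) / 2 := by
  have h := hR.det_pos
  rw [gaussianDensity, Real.log_mul (by positivity) (Real.exp_pos _).ne', Real.log_exp,
    Real.log_inv, Real.log_sqrt (by positivity), Real.log_mul (by positivity) h.ne']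
  ring

lemma log_gaussianCopulaDensity {d : ℕ} {R : Matrix (Fin d) (Fin d) ℝ} (hR : R.PosDef)
    (u : Fin d → ℝ) :
    Real.log (gaussianCopulaDensity R u) = -Real.log R.det / 2
      - ((fun i => score (u i)) ⬝ᵥ R⁻¹.mulVec fun i => score (u i)) / 2
      + ((fun i => score (u i)) ⬝ᵥ fun i => score (u i)) / 2 := by
  rw [gaussianCopulaDensity, Real.log_div (gaussianDensity_pos hR _).ne'
    (gaussianDensity_pos Matrix.PosDef.one _).ne', log_gaussianDensity hR,
    log_gaussianDensity Matrix.PosDef.one]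
  simp only [Matrix.det_one, Real.log_one, inv_one, Matrix.one_mulVec, score]
  ring

lemma coe_ereal_sum {ι : Type*} (s : Finset ι) (f : ι → ℝ) :
    ((∑ i ∈ s, f i : ℝ) : EReal) = ∑ i ∈ s, (f i : EReal) :=
  map_sum (⟨⟨((↑) : ℝ → EReal), EReal.coe_zero⟩, EReal.coe_add⟩ : ℝ →+ EReal) f s

lemma sum_elog_eq {d N : ℕ} {c : Fin N → ℝ} {b : Fin N → Fin d → ℝ} (hc : ∀ t, 0 < c t)
    (hb : ∀ t i, 0 < b t i) :
    ∑ t, (elog (c t) + ∑ i, elog (b t i)) =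
      ((∑ t, (Real.log (c t) + ∑ i, Real.log (b t i)) : ℝ) : EReal) := by
  simp only [elog, ENNReal.log_ofReal_of_pos (hc _), ENNReal.log_ofReal_of_pos (hb _ _),
    coe_ereal_sum, EReal.coe_add]

/-- Positivity keeps every logarithm finite, and the marginal terms and squared scores do not
involve `R`, so they go into `c`. -/
lemma exists_sum_elog_eq_profile {d N : ℕ} (u : Fin N → Fin d → ℝ) {b : Fin N → Fin d → ℝ}
    (hb : ∀ t i, 0 < b t i) :
    ∃ c : ℝ, ∀ R ∈ corrMatrices d,
      ∑ t, (elog (gaussianCopulaDensity R (u t)) + ∑ i, elog (b t i)) =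
        ((profile (fun t i => score (u t i)) R / 2 + c : ℝ) : EReal) := by
  refine ⟨∑ t, (((fun i => score (u t i)) ⬝ᵥ fun i => score (u t i)) / 2 +
    ∑ i, Real.log (b t i)), fun R hR => ?_⟩
  rw [sum_elog_eq (fun t => gaussianCopulaDensity_pos hR.1 (u t)) hb]
  congr 1
  simp only [log_gaussianCopulaDensity hR.1, profile, sampleQuad, Finset.sum_add_distrib,
    Finset.sum_sub_distrib, Finset.sum_const, Finset.card_univ, Fintype.card_fin, nsmul_eq_mul]
  rw [sub_div, Finset.sum_div]
  ring

lemma activeSet_eq_univ {d : ℕ} {x : Fin d → ℝ} (hx : ∀ i, 0 < x i) :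
    activeSet x = Finset.univ :=
  Finset.filter_true_of_mem fun i _ => hx i

/-! ### Convergence of the maximizers of the likelihood -/

/-- The probabilities, severity parameters and sample are arbitrary functions of `p`, so that fixed
and varying samples, with true or estimated probabilities, are all covered. -/
lemma maximizersConverge_logLik {d N : ℕ} {Θ : Fin d → Type*} {F : ∀ i, SeverityFamily (Θ i)}
    {θ : ∀ i, Θ i} {x : Fin N → Fin d → ℝ} (hx : ∀ t i, 0 < x t i)
    (hpdf : ∀ t i, 0 < (F i).pdf (θ i) (x t i))
    (hspan : Submodule.span ℝ (range fun t => normalScores F θ (x t)) = ⊤)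
    {π : (Fin d → ℝ) → Fin d → ℝ} {θp : (Fin d → ℝ) → ∀ i, Θ i}
    {xp : (Fin d → ℝ) → Fin N → Fin d → ℝ}
    (hπ : ∀ᶠ p in toOne d, ∀ i, 0 < π p i)
    (hπ_lim : ∀ i, Tendsto (fun p => π p i) (toOne d) (𝓝 1))
    (hxp : ∀ᶠ p in toOne d, ∀ t i, 0 < xp p t i)
    (hpdfp : ∀ᶠ p in toOne d, ∀ t i, 0 < (F i).pdf (θp p i) (xp p t i))
    (hlim : ∀ t i, Tendsto (fun p => (F i).cdf (θp p i) (xp p t i)) (toOne d)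
      (𝓝 ((F i).cdf (θ i) (x t i)))) :
    MaximizersConverge (fun p => logLik F (π p) (θp p) (xp p)) (limitLogLik F θ x) := by
  have hmem : ∀ t i, (F i).cdf (θ i) (x t i) ∈ Ioo (0 : ℝ) 1 := fun t i =>
    (F i).cdf_mem_Ioo (hx t i) (hpdf t i)
  have hu : ∀ t i, Tendsto (fun p => marginalCdf (F i) (π p i) (θp p i) (xp p t i)) (toOne d)
      (𝓝 ((F i).cdf (θ i) (x t i))) := by
    intro t i
    have h : Tendsto (fun p => 1 - π p i + π p i * (F i).cdf (θp p i) (xp p t i)) (toOne d)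
        (𝓝 (1 - 1 + 1 * (F i).cdf (θ i) (x t i))) :=
      ((hπ_lim i).const_sub 1).add ((hπ_lim i).mul (hlim t i))
    rw [sub_self, zero_add, one_mul] at h
    refine h.congr' ?_
    filter_upwards [hxp] with p hp using (marginalCdf_of_pos _ _ _ (hp t i)).symm
  refine maximizersConverge_of_profile hspan
    (Zp := fun p t i => score (marginalCdf (F i) (π p i) (θp p i) (xp p t i))) ?_ ?_ ?_
  · exact tendsto_pi_nhds.2 fun t => tendsto_pi_nhds.2 fun i =>
      (continuousAt_score (hmem t i)).tendsto.comp (hu t i)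
  · have hIoo : ∀ᶠ p in toOne d, ∀ t i,
        marginalCdf (F i) (π p i) (θp p i) (xp p t i) ∈ Ioo (0 : ℝ) 1 :=
      eventually_all.2 fun t => eventually_all.2 fun i =>
        (hu t i).eventually (Ioo_mem_nhds (hmem t i).1 (hmem t i).2)
    filter_upwards [hIoo, hπ, hxp, hpdfp] with p hp hπp hxp' hpdf'
    obtain ⟨c, hc⟩ := exists_sum_elog_eq_profile
      (fun t i => marginalCdf (F i) (π p i) (θp p i) (xp p t i))
      (b := fun t i => π p i * (F i).pdf (θp p i) (xp p t i))
      fun t i => mul_pos (hπp i) (hpdf' t i)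
    refine ⟨c, fun R hR => (Finset.sum_congr rfl fun t _ => ?_).trans (hc R hR)⟩
    rw [activeSet_eq_univ (hxp' t), mixedPartial_gaussianCopula hR.1 (hp t)]
  · obtain ⟨c, hc⟩ := exists_sum_elog_eq_profile (fun t i => (F i).cdf (θ i) (x t i))
      (b := fun t i => (F i).pdf (θ i) (x t i)) hpdf
    refine ⟨c, fun R hR => (Finset.sum_congr rfl fun t _ => ?_).trans (hc R hR)⟩
    rw [activeSet_eq_univ (hx t)]

lemma eventually_toOne_pos (d : ℕ) : ∀ᶠ p in toOne d, ∀ i, 0 < p i := by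
  filter_upwards [self_mem_nhdsWithin] with p hp i using (hp i).1

lemma tendsto_apply_toOne {d : ℕ} (i : Fin d) :
    Tendsto (fun p : Fin d → ℝ => p i) (toOne d) (𝓝 1) :=
  ((continuous_apply i).tendsto (1 : Fin d → ℝ)).mono_left nhdsWithin_le_nhds

lemma ne_zero_of_span_eq_top {d N : ℕ} {Z : Fin N → Fin d → ℝ}
    (hZ : Submodule.span ℝ (range Z) = ⊤) (i : Fin d) : N ≠ 0 := by
  rintro rfl
  rw [range_eq_empty, Submodule.span_empty] at hZ
  have h : Pi.single i 1 ∈ (⊥ : Submodule ℝ (Fin d → ℝ)) := hZ ▸ Submodule.mem_top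
  rw [Submodule.mem_bot] at h
  simpa using congrFun h i

end CombBernoulli

theorem mainTheorem6 {Ω : Type*} [MeasurableSpace Ω] (μ : Measure Ω) [IsProbabilityMeasure μ]
    (d N : ℕ) (Θ : Fin d → Type*) (F : ∀ i, CombBernoulli.SeverityFamily (Θ i))
    -- the true severity parameters and the true correlation matrix
    (θ₀ : ∀ i, Θ i) (R₀ : Matrix (Fin d) (Fin d) ℝ) (hR₀ : R₀ ∈ CombBernoulli.corrMatrices d)
    -- for each vector of occurrence probabilities `p`, a sample of the model
    (X : (Fin d → ℝ) → Fin N → Ω → Fin d → ℝ)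
    (hX : ∀ p ∈ CombBernoulli.occurrenceBox d, CombBernoulli.IsSample μ F p θ₀ R₀ (X p))
    -- the first-stage estimators, as functions of the univariate samples
    (phat : Fin d → (Fin N → ℝ) → ℝ) (θhat : ∀ i, (Fin N → ℝ) → Θ i)
    (hMLE : ∀ᵐ ω ∂μ, ∀ i, CombBernoulli.IsMarginalMLE (F i) (fun t => X 1 t ω i)
      (phat i (fun t => X 1 t ω i)) (θhat i (fun t => X 1 t ω i)))
    -- the fitted normal scores of the full sample are not contained in a hyperplane
    (hspan : ∀ᵐ ω ∂μ, Submodule.span ℝ (Set.range fun t : Fin N =>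
      CombBernoulli.normalScores F (fun i => θhat i (fun s => X 1 s ω i)) (X 1 t ω)) = ⊤) :
    -- the full sample and its fitted severities are held fixed, and `p → 1` in the likelihood
    (∀ᵐ ω ∂μ, CombBernoulli.MaximizersConverge
      (fun p => CombBernoulli.logLik F p (fun i => θhat i (fun s => X 1 s ω i))
        (fun t => X 1 t ω))
      (CombBernoulli.limitLogLik F (fun i => θhat i (fun s => X 1 s ω i)) (fun t => X 1 t ω))) ∧
    -- the sample varies with `p`, and all the marginal parameters are estimated from it
    ((∀ᵐ ω ∂μ, ∀ᶠ p in CombBernoulli.toOne d, ∀ i,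
        CombBernoulli.IsMarginalMLE (F i) (fun t => X p t ω i)
          (phat i (fun t => X p t ω i)) (θhat i (fun t => X p t ω i))) →
      (∀ᵐ ω ∂μ, ∀ t, Tendsto (fun p => X p t ω) (CombBernoulli.toOne d) (𝓝 (X 1 t ω))) →
      (∀ᵐ ω ∂μ, ∀ i, ∀ x : ℝ, 0 < x → Tendsto
        (fun p => (F i).cdf (θhat i (fun s => X p s ω i)) x) (CombBernoulli.toOne d)
        (𝓝 ((F i).cdf (θhat i (fun s => X 1 s ω i)) x))) →
      ∀ᵐ ω ∂μ,
        CombBernoulli.MaximizersConverge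
          (fun p => CombBernoulli.logLik F (fun i => phat i (fun s => X p s ω i))
            (fun i => θhat i (fun s => X p s ω i)) (fun t => X p t ω))
          (CombBernoulli.limitLogLik F (fun i => θhat i (fun s => X 1 s ω i))
            (fun t => X 1 t ω)) ∧
        CombBernoulli.MaximizersConverge
          (fun p => CombBernoulli.logLik F p
            (fun i => θhat i (fun s => X p s ω i)) (fun t => X p t ω))
          (CombBernoulli.limitLogLik F (fun i => θhat i (fun s => X 1 s ω i))
            (fun t => X 1 t ω))) := by
  have h1 : (1 : Fin d → ℝ) ∈ CombBernoulli.occurrenceBox d := fun _ => ⟨one_pos, le_rfl⟩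
  have hpos := (hX 1 h1).ae_pos
  refine ⟨?_, fun hMLEp hXlim hcdf => ?_⟩
  · filter_upwards [hMLE, hspan, hpos] with ω hM hS hP
    have hpdf : ∀ t i, 0 < (F i).pdf (θhat i fun s => X 1 s ω i) (X 1 t ω i) := fun t i =>
      (hM i).pdf_pos (fun t => (hP t i).1) (fun t => (hP t i).2) t
    exact CombBernoulli.maximizersConverge_logLik (fun t i => (hP t i).1) hpdf hS
      (π := fun p => p) (CombBernoulli.eventually_toOne_pos d) CombBernoulli.tendsto_apply_toOne
      (Eventually.of_forall fun _ t i => (hP t i).1) (Eventually.of_forall fun _ => hpdf)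
      fun _ _ => tendsto_const_nhds
  · filter_upwards [hMLE, hspan, hpos, hMLEp, hXlim, hcdf] with ω hM hS hP hMp hXl hc
    have hpdf : ∀ t i, 0 < (F i).pdf (θhat i fun s => X 1 s ω i) (X 1 t ω i) := fun t i =>
      (hM i).pdf_pos (fun t => (hP t i).1) (fun t => (hP t i).2) t
    have hXi : ∀ t i, Tendsto (fun p => X p t ω i) (CombBernoulli.toOne d) (𝓝 (X 1 t ω i)) :=
      fun t i => tendsto_pi_nhds.1 (hXl t) i
    have hXpos : ∀ᶠ p in CombBernoulli.toOne d, ∀ t i, 0 < X p t ω i :=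
      eventually_all.2 fun t => eventually_all.2 fun i =>
        (hXi t i).eventually (lt_mem_nhds (hP t i).1)
    -- Continuity of the true density keeps `θ₀` a competitor of positive likelihood on the nearby
    -- samples.
    have hpdf₀ : ∀ᶠ p in CombBernoulli.toOne d, ∀ t i, 0 < (F i).pdf (θ₀ i) (X p t ω i) :=
      eventually_all.2 fun t => eventually_all.2 fun i =>
        ((((F i).continuousOn_pdf (θ₀ i)).continuousAt (Ioi_mem_nhds (hP t i).1)).tendsto.comp
          (hXi t i)).eventually (lt_mem_nhds (hP t i).2)
    have hpdfp : ∀ᶠ p in CombBernoulli.toOne d, ∀ t i,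
        0 < (F i).pdf (θhat i fun s => X p s ω i) (X p t ω i) := by
      filter_upwards [hXpos, hpdf₀, hMp] with p hp h0 hm t i using
        (hm i).pdf_pos (fun t => hp t i) (fun t => h0 t i) t
    -- The estimated probabilities are eventually equal to 1, which gives both their positivity and
    -- their limit. The spanning assumption excludes `N = 0`.
    have hone : ∀ᶠ p in CombBernoulli.toOne d, ∀ i, phat i (fun s => X p s ω i) = 1 := by
      filter_upwards [hXpos, hpdf₀, hMp] with p hp h0 hm i using
        (hm i).eq_one (fun t => hp t i) (fun t => h0 t i)
          (CombBernoulli.ne_zero_of_span_eq_top hS i)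
    have hlim : ∀ t i, Tendsto (fun p => (F i).cdf (θhat i fun s => X p s ω i) (X p t ω i))
        (CombBernoulli.toOne d) (𝓝 ((F i).cdf (θhat i fun s => X 1 s ω i) (X 1 t ω i))) :=
      fun t i => (F i).tendsto_cdf (hP t i).1 (hXi t i) (hc i)
    constructor
    · exact CombBernoulli.maximizersConverge_logLik (fun t i => (hP t i).1) hpdf hS
        (π := fun p i => phat i fun s => X p s ω i)
        (by filter_upwards [hone] with p hp i using (hp i).symm ▸ one_pos)
        (fun i => tendsto_const_nhds.congr' (by filter_upwards [hone] with p hp using (hp i).symm))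
        hXpos hpdfp hlim
    · exact CombBernoulli.maximizersConverge_logLik (fun t i => (hP t i).1) hpdf hS
        (π := fun p => p) (CombBernoulli.eventually_toOne_pos d) CombBernoulli.tendsto_apply_toOne
        hXpos hpdfp hlim
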